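/- For a finite set \(E\), a measure on the Boolean lattice \(\{0,1\}^E\) is a probability measure \(\mu\) on \(\{0,1\}^E\), i.e. a function \(\mu\ge 0\) with \(\sum_x\mu(x)=1\); \(X_e\) denotes the \(e\)-th coordinate and \(|x|=\sum_{e} x_e\) the rank of \(x\). Measures that differ only by a renaming of the coordinates are identified. A finite sequence \(q_0,\dots,q_n\) of nonnegative reals is called log-concave if \(q_k^2\ge q_{k-1}q_{k+1}\) for \(0<k<n\) and the indices of its nonzero terms form an interval. Consider the following operations. - Product: from \(\mu\) on \(\{0,1\}^E\) and \(\nu\) on \(\{0,1\}^F\), form \(\mu\times\nu\) on \(\{0,1\}^{E\sqcup F}\). - External field: for \(W:E\to[0,\infty)\), replace \(\mu\) by \(\mu'(x)=C\prod_{e\in E}W(e)^{x_e}\,\mu(x)\), with normalizing constant \(C\) (where \(0^0=1\); allowed whenever the reweighted measure is not zero). - Rank rescaling: for a log-concave sequence \(q_0,\dots,q_n\), \(n=|E|\), replace \(\mu\) by \(\mu'(x)=q_{|x|}\mu(x)\big/\sum_y q_{|y|}\mu(y)\) (allowed whenever the denominator is not zero). - Projection: for \(E'\subseteq E\), replace \(\mu\)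 by the law of \((X_e)_{e\in E'}\). A measure \(\mu\) on \(\{0,1\}^E\) is jointly negative regression dependent (JNRD) if for every \(A\subseteq E\) and every increasing event \(H\) measurable with respect to \(\{X_e:e\in A\}\), one has \(\mu(H\mid X_e=\eta'_e,\ e\notin A)\le\mu(H\mid X_e=\eta_e,\ e\notin A)\) for all \(\eta\le\eta'\) in \(\{0,1\}^{E\setminus A}\) for which both conditioning events have positive probability. The measure \(\mu\) is JNRD+ if \(\mu\), and every measure obtained from \(\mu\) by an external field followed by a projection, is JNRD. Theorem. Let \(\mathcal S\) be the smallest class of measures on Boolean lattices that contains the laws of single Bernoulli variables (with any parameter \(p\in[0,1]\)) and is closed under products, external fields and rank rescaling. Then every measure in \(\mathcal S\) is JNRD+. -/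

import Mathlib

/-!
Probability measures on finite Boolean lattices `{0,1}^E`, the operations on them (products,
external fields, rank rescalings, projections), and joint negative regression dependence.
The lattice `{0,1}^E` is `E → Bool` with its pointwise order (`false ≤ true`).
-/

universe u

open Classical in
/-- A probability measure on the Boolean lattice `{0,1}^E`: a nonnegative function of total
mass one. -/
@[ext]
structure BoolMeasure (E : Type u) [Fintype E] where
  mass : (E → Bool) → ℝ
  nonneg : ∀ x, 0 ≤ mass x
  sum_eq_one : ∑ x, mass x = 1

/-- The rank `|x|`: the number of coordinates of `x` that are `1`. -/
def boolRank {E : Type u} [Fintype E] (x : E → Bool) : ℕ :=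
  (Finset.univ.filter fun e => x e = true).card

/-- The sequence `q 0, …, q n` is log-concave: it is nonnegative, satisfies
`q k ^ 2 ≥ q (k - 1) * q (k + 1)`, and the indices of its nonzero terms form an interval.
Values of `q` beyond `n` play no role. -/
structure IsLogConcaveUpTo (n : ℕ) (q : ℕ → ℝ) : Prop where
  nonneg : ∀ k, k ≤ n → 0 ≤ q k
  mul_le_sq : ∀ k, k + 2 ≤ n → q k * q (k + 2) ≤ q (k + 1) ^ 2
  support_interval : ∀ i j k, i ≤ j → j ≤ k → k ≤ n → q i ≠ 0 → q k ≠ 0 → q j ≠ 0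

namespace BoolMeasure

open Classical in
/-- The probability measure proportional to a nonnegative weight of positive total mass. -/
noncomputable def normalize {E : Type u} [Fintype E] (w : (E → Bool) → ℝ)
    (hw : ∀ x, 0 ≤ w x) (hZ : 0 < ∑ x, w x) : BoolMeasure E where
  mass x := w x / ∑ y, w y
  nonneg x := div_nonneg (hw x) hZ.le
  sum_eq_one := by rw [← Finset.sum_div, div_self hZ.ne']

/-- The law of a single Bernoulli variable with `P(X = 1) = p`. -/
def bernoulli (p : ℝ) (hp0 : 0 ≤ p) (hp1 : p ≤ 1) : BoolMeasure PUnit.{u + 1} where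
  mass x := if x PUnit.unit = true then p else 1 - p
  nonneg x := by split_ifs <;> linarith
  sum_eq_one := by
    refine Eq.trans ?_ (show ∑ b : Bool, (if b = true then p else 1 - p) = 1 by simp)
    exact Finset.sum_equiv (Equiv.funUnique PUnit.{u + 1} Bool) (by simp) (fun x _ => rfl)

/-- The product measure; the index set is the disjoint union of the two index sets. -/
def prod {E F : Type u} [Fintype E] [Fintype F] (μ : BoolMeasure E) (ν : BoolMeasure F) :
    BoolMeasure (E ⊕ F) where
  mass x := μ.mass (fun e => x (Sum.inl e)) * ν.mass (fun f => x (Sum.inr f))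
  nonneg x := mul_nonneg (μ.nonneg _) (ν.nonneg _)
  sum_eq_one := by
    classical
    suffices h : ∑ z : (E → Bool) × (F → Bool), μ.mass z.1 * ν.mass z.2 = 1 by
      exact (Finset.sum_equiv (Equiv.sumArrowEquivProdArrow E F Bool) (by simp)
        (fun x _ => rfl)).trans h
    rw [Fintype.sum_prod_type, ← Fintype.sum_mul_sum]
    have h1 : ∑ x, μ.mass x = 1 := by convert μ.sum_eq_one
    have h2 : ∑ x, ν.mass x = 1 := by convert ν.sum_eq_one
    rw [h1, h2, one_mul]

/-- Transport of a measure along a renaming `e` of the coordinates. -/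
def relabel {E F : Type u} [Fintype E] [Fintype F] (μ : BoolMeasure E) (e : E ≃ F) :
    BoolMeasure F where
  mass y := μ.mass (fun i => y (e i))
  nonneg y := μ.nonneg _
  sum_eq_one := by
    classical
    refine (Fintype.sum_equiv (e.symm.arrowCongr (Equiv.refl Bool)) _ μ.mass
      (fun x => rfl)).trans ?_
    convert μ.sum_eq_one

/-- The unnormalized weight `η ↦ (∏ e, W e ^ η e) * μ η` of an external field. -/
def fieldWeight {E : Type u} [Fintype E] (μ : BoolMeasure E) (W : E → ℝ) (x : E → Bool) : ℝ :=
  (∏ e, if x e = true then W e else 1) * μ.mass x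

theorem fieldWeight_nonneg {E : Type u} [Fintype E] (μ : BoolMeasure E) {W : E → ℝ}
    (hW : ∀ e, 0 ≤ W e) (x : E → Bool) : 0 ≤ μ.fieldWeight W x := by
  refine mul_nonneg (Finset.prod_nonneg fun e _ => ?_) (μ.nonneg x)
  split_ifs
  · exact hW e
  · exact zero_le_one

open Classical in
/-- Imposition of the external field `W ≥ 0`, defined when the reweighted measure is not the
zero measure. -/
noncomputable def externalField {E : Type u} [Fintype E] (μ : BoolMeasure E) (W : E → ℝ)
    (hW : ∀ e, 0 ≤ W e) (hZ : 0 < ∑ x, μ.fieldWeight W x) : BoolMeasure E :=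
  normalize (μ.fieldWeight W) (μ.fieldWeight_nonneg hW) hZ

theorem boolRank_le_card {E : Type u} [Fintype E] (x : E → Bool) :
    boolRank x ≤ Fintype.card E :=
  Finset.card_le_univ _

open Classical in
/-- The rank rescaling of `μ` by a log-concave sequence `q 0, …, q n`, `n = |E|`, defined when
the rescaled measure is not the zero measure. -/
noncomputable def rankRescale {E : Type u} [Fintype E] (μ : BoolMeasure E) (q : ℕ → ℝ)
    (hq : IsLogConcaveUpTo (Fintype.card E) q) (hZ : 0 < ∑ x, q (boolRank x) * μ.mass x) :
    BoolMeasure E :=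
  normalize (fun x => q (boolRank x) * μ.mass x)
    (fun x => mul_nonneg (hq.nonneg _ (boolRank_le_card x)) (μ.nonneg x)) hZ

open Classical in
/-- The probability of an event. -/
noncomputable def prob {E : Type u} [Fintype E] (μ : BoolMeasure E) (S : Set (E → Bool)) : ℝ :=
  ∑ x, S.indicator μ.mass x

open Classical in
/-- The projection of `μ` onto `{0,1}^E'`, forgetting the variables outside `E'`. -/
noncomputable def proj {E : Type u} [Fintype E] (μ : BoolMeasure E) (E' : Finset E) :
    BoolMeasure E' where
  mass y := μ.prob {x | (fun e : E' => x e) = y}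
  nonneg y := Finset.sum_nonneg fun x _ => Set.indicator_nonneg (fun z _ => μ.nonneg z) x
  sum_eq_one := by
    unfold prob
    rw [Finset.sum_comm]
    simp only [Set.indicator_apply, Set.mem_ofPred_eq, Finset.sum_ite_eq, Finset.mem_univ,
      if_true]
    exact μ.sum_eq_one

/-- The conditional probability of `S` given `T`; only used when `T` has positive
probability. -/
noncomputable def condProb {E : Type u} [Fintype E] (μ : BoolMeasure E)
    (S T : Set (E → Bool)) : ℝ :=
  μ.prob (S ∩ T) / μ.prob T

/-- Joint negative regression dependence: for every `A ⊆ E` and every increasing event `H` in the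
variables indexed by `A`, the conditional probability of `H` given `X_e = η e` for all `e ∉ A`
is decreasing in `η`, where `η` ranges over the configurations outside `A` that have positive
probability. -/
def JNRD {E : Type u} [Fintype E] (μ : BoolMeasure E) : Prop :=
  ∀ (A : Set E) (H : Set (A → Bool)), IsUpperSet H →
    ∀ η η' : (Aᶜ : Set E) → Bool, η ≤ η' →
      0 < μ.prob {x | (fun e : (Aᶜ : Set E) => x e) = η} →
      0 < μ.prob {x | (fun e : (Aᶜ : Set E) => x e) = η'} →
      μ.condProb {x | (fun e : A => x e) ∈ H} {x | (fun e : (Aᶜ : Set E) => x e) = η'} ≤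
        μ.condProb {x | (fun e : A => x e) ∈ H} {x | (fun e : (Aᶜ : Set E) => x e) = η}

open Classical in
/-- JNRD+: `μ`, and every measure obtained from `μ` by an external field followed by a
projection, is jointly negative regression dependent. -/
def JNRDPlus {E : Type u} [Fintype E] (μ : BoolMeasure E) : Prop :=
  μ.JNRD ∧
    ∀ (W : E → ℝ) (hW : ∀ e, 0 ≤ W e) (hZ : 0 < ∑ x, μ.fieldWeight W x) (E' : Finset E),
      ((μ.externalField W hW hZ).proj E').JNRD

open Classical in
/-- The smallest class of measures on finite Boolean lattices that contains the laws of single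
Bernoulli variables and is closed under products, external fields and rank rescaling.
The names of the coordinates are immaterial, hence the closure under relabeling. -/
inductive ClosedClass : ∀ {E : Type u} [Fintype E], BoolMeasure E → Prop
  | bernoulli (p : ℝ) (hp0 : 0 ≤ p) (hp1 : p ≤ 1) :
      ClosedClass (BoolMeasure.bernoulli.{u} p hp0 hp1)
  | relabel {E F : Type u} [Fintype E] [Fintype F] (μ : BoolMeasure E) (e : E ≃ F) :
      ClosedClass μ → ClosedClass (μ.relabel e)
  | prod {E F : Type u} [Fintype E] [Fintype F] (μ : BoolMeasure E) (ν : BoolMeasure F) :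
      ClosedClass μ → ClosedClass ν → ClosedClass (μ.prod ν)
  | externalField {E : Type u} [Fintype E] (μ : BoolMeasure E) (W : E → ℝ)
      (hW : ∀ e, 0 ≤ W e) (hZ : 0 < ∑ x, μ.fieldWeight W x) :
      ClosedClass μ → ClosedClass (μ.externalField W hW hZ)
  | rankRescale {E : Type u} [Fintype E] (μ : BoolMeasure E) (q : ℕ → ℝ)
      (hq : IsLogConcaveUpTo (Fintype.card E) q)
      (hZ : 0 < ∑ x, q (boolRank x) * μ.mass x) :
      ClosedClass μ → ClosedClass (μ.rankRescale q hq hZ)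

end BoolMeasure

/-! Call a positive weight on the cube covering (`IsCovering`) if two properties hold under every
external field, zeros allowed so that coordinates may be frozen. Rank monotonicity: the rank
sequence is log-concave without internal zeros, and the law given rank k + 1 stochastically
dominates the law given rank k. Flip property: after any log-concave rank rescaling, the laws given
X_d = 0 and X_d = 1 have a coupling (x, y) in which, away from d, x equals y or exceeds it in
exactly one coordinate.

The two properties sustain each other under products. Integrating out one factor of a rank-rescaled
product reweights the other by a log-concave function of its rank, which the quantifier over
rescalings absorbs. If the first factor's rank then differs by one between the two laws, rank
monotonicity of the second factor lets it compensate (`RankMonotone.dominates_shift`). This drives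
`RankMonotone.prod` and `FlipDominates.prod_left`; rescalings and fields are built into the
definitions.

For a positive weight, the flip property gives negative regression by changing the conditioning one
coordinate at a time, since no intermediate event is null. With zeros such a path may break, so
every member of the class is exhibited as a limit of covering weights, and the cross-multiplied
inequality passes to the limit. Finally, external fields stay in the class and JNRD survives
projection.

Couplings enter through their dual inequality, `Dominates`, cross-multiplied so that laws of zero
mass need no separate treatment. -/

/-! ### Log-concave sequences as totally positive sequences of order two. -/

/-- A nonnegative sequence all of whose `2 × 2` Toeplitz minors are nonnegative. -/
structure IsPF2 (q : ℕ → ℝ) : Prop where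
  nonneg : ∀ k, 0 ≤ q k
  mul_le : ∀ a b m, a ≤ b → q a * q (b + m) ≤ q (a + m) * q b

namespace IsPF2

variable {p q : ℕ → ℝ}

theorem const {c : ℝ} (hc : 0 ≤ c) : IsPF2 fun _ => c :=
  ⟨fun _ => hc, fun _ _ _ _ => le_rfl⟩

theorem mul (hp : IsPF2 p) (hq : IsPF2 q) : IsPF2 fun k => p k * q k where
  nonneg k := mul_nonneg (hp.nonneg k) (hq.nonneg k)
  mul_le a b m hab := by
    have := mul_le_mul (hp.mul_le a b m hab) (hq.mul_le a b m hab)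
      (mul_nonneg (hq.nonneg _) (hq.nonneg _)) (mul_nonneg (hp.nonneg _) (hp.nonneg _))
    linarith

theorem shift (hq : IsPF2 q) (i : ℕ) : IsPF2 fun k => q (i + k) where
  nonneg k := hq.nonneg _
  mul_le a b m hab := by
    simpa only [add_assoc] using hq.mul_le (i + a) (i + b) m (by omega)

theorem reverse (hq : IsPF2 q) (n : ℕ) : IsPF2 fun k => if k ≤ n then q (n - k) else 0 where
  nonneg k := by
    split_ifs
    · exact hq.nonneg _
    · exact le_rfl
  mul_le a b m hab := by
    by_cases h : b + m ≤ n
    · rw [if_pos (by omega), if_pos h, if_pos (by omega), if_pos (by omega)]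
      have := hq.mul_le (n - (b + m)) (n - (a + m)) m (by omega)
      rw [show n - (a + m) + m = n - a by omega, show n - (b + m) + m = n - b by omega] at this
      linarith
    · rw [if_neg h, mul_zero]
      apply mul_nonneg <;> split_ifs <;> first | exact hq.nonneg _ | exact le_rfl

/-- Composition of totally positive kernels of order two. -/
theorem _root_.sum_mul_minor_nonneg (s : Finset ℕ) (F F' G G' : ℕ → ℝ)
    (hF : ∀ m n, m ≤ n → F n * F' m ≤ F m * F' n)
    (hG : ∀ m n, m ≤ n → G' m * G n ≤ G m * G' n) :
    (∑ m ∈ s, F m * G' m) * ∑ m ∈ s, F' m * G m ≤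
      (∑ m ∈ s, F m * G m) * ∑ m ∈ s, F' m * G' m := by
  rw [Finset.sum_mul_sum, Finset.sum_mul_sum, ← sub_nonneg, ← Finset.sum_sub_distrib]
  simp_rw [← Finset.sum_sub_distrib]
  set T : ℕ → ℕ → ℝ := fun m n => F m * G m * (F' n * G' n) - F m * G' m * (F' n * G n)
  -- Symmetrizing over (m, n) turns each term into a product of two minors of equal sign, as in
  -- Cauchy–Binet.
  have h2 : ∑ m ∈ s, ∑ n ∈ s, T m n = ∑ m ∈ s, ∑ n ∈ s, T n m := Finset.sum_comm
  have h3 : 0 ≤ ∑ m ∈ s, ∑ n ∈ s, (T m n + T n m) := by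
    refine Finset.sum_nonneg fun m _ => Finset.sum_nonneg fun n _ => ?_
    have : T m n + T n m = (F m * F' n - F n * F' m) * (G m * G' n - G' m * G n) := by
      simp only [T]; ring
    rw [this]
    rcases le_total m n with h | h
    · exact mul_nonneg (sub_nonneg.2 (hF m n h)) (sub_nonneg.2 (hG m n h))
    · refine mul_nonneg_of_nonpos_of_nonpos (sub_nonpos.2 (hF n m h)) (sub_nonpos.2 ?_)
      have := hG n m h
      linarith
  simp only [Finset.sum_add_distrib] at h3
  change 0 ≤ ∑ m ∈ s, ∑ n ∈ s, T m n
  linarith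

theorem toeplitz_le (hq : IsPF2 q) {i i' k k' : ℕ} (hi : i ≤ i') (hk : k ≤ k') :
    (if k' ≤ i then q (i - k') else 0) * (if k ≤ i' then q (i' - k) else 0) ≤
      (if k ≤ i then q (i - k) else 0) * (if k' ≤ i' then q (i' - k') else 0) := by
  by_cases h : k' ≤ i
  · rw [if_pos h, if_pos (by omega), if_pos (by omega), if_pos (by omega)]
    have := hq.mul_le (i - k') (i' - k') (k' - k) (by omega)
    rwa [show i' - k' + (k' - k) = i' - k by omega, show i - k' + (k' - k) = i - k by omega]
      at this
  · rw [if_neg h, zero_mul]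
    apply mul_nonneg <;> split_ifs <;> first | exact hq.nonneg _ | exact le_rfl

/-- The convolution of two sequences. -/
def conv (p q : ℕ → ℝ) (k : ℕ) : ℝ := ∑ i ∈ Finset.range (k + 1), p i * q (k - i)

theorem sum_toeplitz_mul (p q : ℕ → ℝ) {i k N : ℕ} (hk : k ≤ i) (hN : i ≤ N) :
    ∑ m ∈ Finset.range (N + 1),
      (if m ≤ i then q (i - m) else 0) * (if k ≤ m then p (m - k) else 0) =
        conv p q (i - k) := by
  have : ∑ m ∈ Finset.range (N + 1),
      (if m ≤ i then q (i - m) else 0) * (if k ≤ m then p (m - k) else 0) =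
      ∑ m ∈ Finset.Ico k (i + 1),
        (if m ≤ i then q (i - m) else 0) * (if k ≤ m then p (m - k) else 0) := by
    symm
    apply Finset.sum_subset
    · intro m; simp only [Finset.mem_Ico, Finset.mem_range]; omega
    · intro m _ hm
      simp only [Finset.mem_Ico, not_and_or, not_le, not_lt] at hm
      rcases hm with hm | hm
      · rw [if_neg (by omega : ¬ k ≤ m), mul_zero]
      · rw [if_neg (by omega : ¬ m ≤ i), zero_mul]
  rw [this, Finset.sum_Ico_eq_sum_range, conv, show i + 1 - k = i - k + 1 by omega]
  refine Finset.sum_congr rfl fun j hj => ?_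
  have := Finset.mem_range.1 hj
  rw [if_pos (by omega), if_pos (by omega), mul_comm, show k + j - k = j by omega,
    show i - (k + j) = i - k - j by omega]

/-- The Toeplitz matrix of a convolution is the product of the Toeplitz matrices; the minor needed
has rows a + m, b + m and columns 0, m. -/
theorem isPF2_conv (hp : IsPF2 p) (hq : IsPF2 q) : IsPF2 (conv p q) where
  nonneg k := Finset.sum_nonneg fun i _ => mul_nonneg (hp.nonneg _) (hq.nonneg _)
  mul_le a b m hab := by
    have := sum_mul_minor_nonneg (Finset.range (b + m + 1))
      (fun n => if n ≤ a + m then q (a + m - n) else 0)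
      (fun n => if n ≤ b + m then q (b + m - n) else 0)
      (fun n => if 0 ≤ n then p (n - 0) else 0)
      (fun n => if m ≤ n then p (n - m) else 0)
      (fun _ _ h => hq.toeplitz_le (by omega) h)
      (fun _ _ h => hp.toeplitz_le h (Nat.zero_le m))
    rwa [sum_toeplitz_mul p q (by omega) (by omega), sum_toeplitz_mul p q (by omega) (by omega),
      sum_toeplitz_mul p q (by omega) (by omega), sum_toeplitz_mul p q (by omega) (by omega),
      Nat.add_sub_cancel, Nat.add_sub_cancel, Nat.sub_zero, Nat.sub_zero] at this

/-- The correlation of a finitely supported sequence with another one. -/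
theorem correlation (hp : IsPF2 p) (hq : IsPF2 q) (n : ℕ) :
    IsPF2 fun i => ∑ j ∈ Finset.range (n + 1), p j * q (i + j) := by
  -- Correlating with p is convolving with p reversed on 0, …, n and reading the result from index n
  -- on.
  convert ((hp.reverse n).isPF2_conv hq).shift n using 2 with i
  rw [conv, ← Finset.sum_subset (Finset.range_subset_range.2 (by omega : n + 1 ≤ n + i + 1)),
    ← Finset.sum_range_reflect]
  · refine Finset.sum_congr rfl fun j hj => ?_
    have := Finset.mem_range.1 hj
    rw [if_pos (by omega), show n + 1 - 1 - j = n - j by omega,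
      show i + (n - j) = n + i - j by omega]
  · intro j _ hj
    rw [Finset.mem_range] at hj
    rw [if_neg (by omega), zero_mul]

/-- The two sides have exponents differing by 2m(b - a) ≥ 0. These sequences serve to smooth a
log-concave sequence into a positive one. -/
theorem gaussian {ε : ℝ} (h0 : 0 ≤ ε) (h1 : ε ≤ 1) (n : ℕ) :
    IsPF2 fun k => ε ^ (((k : ℤ) - n).natAbs ^ 2) where
  nonneg k := pow_nonneg h0 _
  mul_le a b m hab := by
    rw [← pow_add, ← pow_add]
    refine pow_le_pow_of_le_one h0 h1 ?_
    zify
    simp only [sq_abs]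
    have : (0 : ℤ) ≤ (m : ℤ) * (b - a) := mul_nonneg (by positivity) (by omega)
    nlinarith

/-- If both outer terms are nonzero, the interval condition makes everything between them positive,
so successive ratios are decreasing there and the local inequalities chain, first for m = 1 and then
by induction on m. -/
theorem of_isLogConcaveUpTo {n : ℕ} (hq : IsLogConcaveUpTo n q) :
    IsPF2 fun k => if k ≤ n then q k else 0 := by
  have h0 : ∀ k, 0 ≤ if k ≤ n then q k else 0 := fun k => by
    split_ifs with h
    · exact hq.nonneg k h
    · exact le_rfl
  refine ⟨h0, fun a b m hab => ?_⟩
  by_cases hn : b + m ≤ n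
  swap
  · rw [if_neg hn, mul_zero]; exact mul_nonneg (h0 _) (h0 _)
  rw [if_pos (by omega), if_pos hn, if_pos (by omega), if_pos (by omega)]
  have nn := hq.nonneg
  by_cases ha : q a = 0
  · rw [ha, zero_mul]; exact mul_nonneg (nn _ (by omega)) (nn _ (by omega))
  by_cases hb : q (b + m) = 0
  · rw [hb, mul_zero]; exact mul_nonneg (nn _ (by omega)) (nn _ (by omega))
  have pos : ∀ k, a ≤ k → k ≤ b + m → 0 < q k := fun k h1 h2 =>
    lt_of_le_of_ne (nn k (by omega)) (hq.support_interval a k (b + m) h1 h2 hn ha hb).symm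
  have step : ∀ i j, a ≤ i → i ≤ j → j + 1 ≤ b + m → q i * q (j + 1) ≤ q (i + 1) * q j := by
    intro i j hi hij
    induction j, hij using Nat.le_induction with
    | base => intro _; exact (mul_comm _ _).le
    | succ j hij ih =>
      intro hj
      have h1 := ih (by omega)
      have h2 := hq.mul_le_sq j (by omega)
      have p1 := pos j (by omega) (by omega)
      have p2 := pos (j + 1) (by omega) (by omega)
      have p3 := pos (j + 1 + 1) (by omega) (by omega)
      have p4 := pos (i + 1) (by omega) (by omega)
      refine le_of_mul_le_mul_right ?_ (mul_pos p1 p2)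
      calc q i * q (j + 1 + 1) * (q j * q (j + 1))
          = (q i * q (j + 1)) * (q j * q (j + 2)) := by ring
        _ ≤ (q (i + 1) * q j) * q (j + 1) ^ 2 := mul_le_mul h1 h2 (by positivity) (by positivity)
        _ = _ := by ring
  clear hb
  induction m with
  | zero => exact le_rfl
  | succ m ih =>
    have h1 := ih (by omega) (fun k h1 h2 => pos k h1 (by omega))
      (fun i j h1 h2 h3 => step i j h1 h2 (by omega))
    have h2 := step (a + m) (b + m) (by omega) (by omega) (by omega)
    have p1 := pos (a + m) (by omega) (by omega)
    have p2 := pos (b + m) (by omega) (by omega)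
    have p3 := pos a (by omega) (by omega)
    have p4 := pos b (by omega) (by omega)
    have p5 := pos (b + m + 1) (by omega) (by omega)
    refine le_of_mul_le_mul_right ?_ (mul_pos p1 p2)
    calc q a * q (b + (m + 1)) * (q (a + m) * q (b + m))
        = (q a * q (b + m)) * (q (a + m) * q (b + m + 1)) := by rw [← add_assoc]; ring
      _ ≤ (q (a + m) * q b) * (q (a + m + 1) * q (b + m)) :=
          mul_le_mul h1 h2 (by positivity) (by positivity)
      _ = _ := by rw [← add_assoc]; ring

end IsPF2

/-! ### Comparison of laws on the integers. -/

/-- The likelihood ratio order implies the stochastic order. -/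
theorem sum_range_mul_le_of_ratio {p q : ℕ → ℝ} (h : ∀ i j, i ≤ j → p i * q j ≤ q i * p j)
    {k M : ℕ} (hk : k ≤ M) :
    (∑ i ∈ Finset.range k, p i) * ∑ i ∈ Finset.range M, q i ≤
      (∑ i ∈ Finset.range k, q i) * ∑ i ∈ Finset.range M, p i := by
  rw [← Finset.sum_range_add_sum_Ico q hk, ← Finset.sum_range_add_sum_Ico p hk, mul_add, mul_add,
    mul_comm (∑ i ∈ Finset.range k, q i) (∑ i ∈ Finset.range k, p i)]
  gcongr 1
  rw [Finset.sum_mul_sum, Finset.sum_mul_sum]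
  refine Finset.sum_le_sum fun i hi => Finset.sum_le_sum fun j hj => h i j ?_
  have := Finset.mem_range.1 hi
  have := (Finset.mem_Ico.1 hj).1
  omega

/-- If `b` is below `a` and `a` is below the shift of `b` in the likelihood ratio order, then `a`
and `b` can be coupled so that they differ by `0` or `1`; this is the dual statement. -/
theorem sum_range_mul_le_of_interlacing {N : ℕ} {a b : ℕ → ℝ} (ha : ∀ k, 0 ≤ a k)
    (hb : ∀ k, 0 ≤ b k) (haN : a (N + 1) = 0)
    (h1 : ∀ i j, i ≤ j → a i * b j ≤ b i * a j)
    (h2 : ∀ i j, i ≤ j → b i * a (j + 1) ≤ a (i + 1) * b j) {H H' : ℕ → ℝ}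
    (hH : ∀ k, a k ≠ 0 → b k ≠ 0 → H' k ≤ H k)
    (hH' : ∀ k, a (k + 1) ≠ 0 → b k ≠ 0 → H' k ≤ H (k + 1)) :
    (∑ k ∈ Finset.range (N + 1), b k * H' k) * ∑ k ∈ Finset.range (N + 1), a k ≤
      (∑ k ∈ Finset.range (N + 1), a k * H k) * ∑ k ∈ Finset.range (N + 1), b k := by
  set A := ∑ k ∈ Finset.range (N + 1), a k with hA
  set B := ∑ k ∈ Finset.range (N + 1), b k with hB
  -- The monotone coupling, scaled by A * B: the mass of `a` at k splits into `s k`, matched with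
  -- `b` at k, and `t k`, matched with `b` at k - 1.
  set t : ℕ → ℝ := fun k => A * (∑ i ∈ Finset.range k, b i) - B * ∑ i ∈ Finset.range k, a i
    with ht
  set s : ℕ → ℝ := fun k => B * (∑ i ∈ Finset.range (k + 1), a i) - A * ∑ i ∈ Finset.range k, b i
    with hs
  have t_nonneg : ∀ k, k ≤ N + 1 → 0 ≤ t k := fun k hk => by
    have := sum_range_mul_le_of_ratio h1 hk
    simp only [ht]; linarith
  have s_nonneg : ∀ k, k ≤ N → 0 ≤ s k := fun k hk => by
    -- `b'` is `b` moved up by one. Comparing it with `a` up to N + 1 includes all of its mass, and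
    -- `haN` makes the extra term of `a` vanish.
    set b' : ℕ → ℝ := fun j => Nat.casesOn j 0 b with hb'
    have hsum : ∀ j, ∑ i ∈ Finset.range (j + 1), b' i = ∑ i ∈ Finset.range j, b i := fun j => by
      rw [Finset.sum_range_succ']; simp [hb']
    have := sum_range_mul_le_of_ratio (p := b') (q := a) (k := k + 1) (M := N + 1 + 1) (by
      rintro (_ | i) (_ | j) hij
      · simp [hb']
      · simpa [hb'] using mul_nonneg (ha 0) (hb j)
      · omega
      · exact h2 i j (by omega)) (by omega)
    rw [hsum, hsum, Finset.sum_range_succ a (N + 1), haN, add_zero] at this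
    simp only [hs]; linarith
  have e1 : ∀ k, B * a k = s k + t k := fun k => by
    simp only [hs, ht, Finset.sum_range_succ]; ring
  have e2 : ∀ k, A * b k = s k + t (k + 1) := fun k => by
    simp only [hs, ht, Finset.sum_range_succ]; ring
  have t0 : t 0 = 0 := by simp [ht]
  have tN : t (N + 1) = 0 := by simp only [ht, ← hA, ← hB]; ring
  have hshift : ∑ k ∈ Finset.range (N + 1), t k * H k =
      ∑ k ∈ Finset.range (N + 1), t (k + 1) * H (k + 1) := by
    have := Finset.sum_range_succ (fun k => t k * H k) (N + 1)
    rw [Finset.sum_range_succ', tN, t0] at this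
    simpa using this.symm
  have key : (∑ k ∈ Finset.range (N + 1), a k * H k) * B -
      (∑ k ∈ Finset.range (N + 1), b k * H' k) * A =
      ∑ k ∈ Finset.range (N + 1), (s k * (H k - H' k) + t (k + 1) * (H (k + 1) - H' k)) := by
    calc _ = ∑ k ∈ Finset.range (N + 1), (B * a k * H k - A * b k * H' k) := by
          rw [Finset.sum_mul, Finset.sum_mul, ← Finset.sum_sub_distrib]
          exact Finset.sum_congr rfl fun k _ => by ring
      _ = ∑ k ∈ Finset.range (N + 1), (s k * (H k - H' k) - t (k + 1) * H' k) +
          ∑ k ∈ Finset.range (N + 1), t k * H k := by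
          rw [← Finset.sum_add_distrib]
          exact Finset.sum_congr rfl fun k _ => by rw [e1, e2]; ring
      _ = _ := by
          rw [hshift, ← Finset.sum_add_distrib]
          exact Finset.sum_congr rfl fun k _ => by ring
  rw [← sub_nonneg, key]
  refine Finset.sum_nonneg fun k hk => ?_
  have hk' : k ≤ N := by have := Finset.mem_range.1 hk; omega
  have sk := s_nonneg k hk'
  have tk := t_nonneg k (by omega)
  have tk1 := t_nonneg (k + 1) (by omega)
  refine add_nonneg ?_ ?_
  · by_cases h : a k = 0 ∨ b k = 0
    · have : s k = 0 := by
        rcases h with h | h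
        · have := e1 k; rw [h, mul_zero] at this; linarith
        · have := e2 k; rw [h, mul_zero] at this; linarith
      rw [this, zero_mul]
    · rw [not_or] at h
      exact mul_nonneg sk (sub_nonneg.2 (hH k h.1 h.2))
  · by_cases h : a (k + 1) = 0 ∨ b k = 0
    · have : t (k + 1) = 0 := by
        rcases h with h | h
        · rcases hk'.lt_or_eq with hlt | rfl
          · have := e1 (k + 1); rw [h, mul_zero] at this
            have := s_nonneg (k + 1) hlt
            linarith
          · exact tN
        · have := e2 k; rw [h, mul_zero] at this; linarith
      rw [this, zero_mul]
    · rw [not_or] at h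
      exact mul_nonneg tk1 (sub_nonneg.2 (hH' k h.1 h.2))

/-! ### Couplings in dual form. -/

/-- Dual form of the statement that the normalizations of `f` and `g` have a coupling supported
on the relation `R`. -/
def Dominates {X Y : Type*} [Fintype X] [Fintype Y] (R : X → Y → Prop) (f : X → ℝ) (g : Y → ℝ) :
    Prop :=
  ∀ (h : X → ℝ) (h' : Y → ℝ), (∀ x y, f x ≠ 0 → g y ≠ 0 → R x y → h' y ≤ h x) →
    (∑ y, g y * h' y) * ∑ x, f x ≤ (∑ x, f x * h x) * ∑ y, g y

namespace Dominates

variable {X Y : Type*} [Fintype X] [Fintype Y] {R R' : X → Y → Prop} {f : X → ℝ} {g : Y → ℝ}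

/-- This is the independent coupling. -/
theorem of_forall (hf : ∀ x, 0 ≤ f x) (hg : ∀ y, 0 ≤ g y)
    (hR : ∀ x y, f x ≠ 0 → g y ≠ 0 → R x y) : Dominates R f g := by
  intro h h' hh
  rw [mul_comm, Finset.sum_mul_sum, Finset.sum_mul_sum]
  refine Finset.sum_le_sum fun x _ => Finset.sum_le_sum fun y _ => ?_
  by_cases hx : f x = 0
  · simp [hx]
  by_cases hy : g y = 0
  · simp [hy]
  have := mul_le_mul_of_nonneg_left (hh x y hx hy (hR x y hx hy)) (mul_nonneg (hf x) (hg y))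
  linarith

theorem refl {R : X → X → Prop} (hf : ∀ x, 0 ≤ f x) (hR : ∀ x, R x x) : Dominates R f f := by
  intro h h' hh
  refine mul_le_mul_of_nonneg_right (Finset.sum_le_sum fun x _ => ?_)
    (Finset.sum_nonneg fun x _ => hf x)
  by_cases hx : f x = 0
  · simp [hx]
  · exact mul_le_mul_of_nonneg_left (hh x x hx hx (hR x)) (hf x)

theorem mono (H : Dominates R f g) (hR : ∀ x y, f x ≠ 0 → g y ≠ 0 → R x y → R' x y) :
    Dominates R' f g :=
  fun h h' hh => H h h' fun x y hx hy hxy => hh x y hx hy (hR x y hx hy hxy)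

theorem smul (H : Dominates R f g) {c d : ℝ} (hc : 0 ≤ c) (hd : 0 ≤ d) :
    Dominates R (fun x => c * f x) (fun y => d * g y) := by
  intro h h' hh
  simp only [mul_assoc, ← Finset.mul_sum]
  rcases hc.eq_or_lt with rfl | hc'
  · simp
  rcases hd.eq_or_lt with rfl | hd'
  · simp
  have := H h h' fun x y hx hy => hh x y (mul_ne_zero hc'.ne' hx) (mul_ne_zero hd'.ne' hy)
  have := mul_le_mul_of_nonneg_left this (mul_nonneg hc hd)
  linarith

theorem comp_equiv {X' Y' : Type*} [Fintype X'] [Fintype Y'] (H : Dominates R f g)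
    (α : X' ≃ X) (β : Y' ≃ Y) :
    Dominates (fun x y => R (α x) (β y)) (fun x => f (α x)) (fun y => g (β y)) := by
  intro h h' hh
  have := H (fun x => h (α.symm x)) (fun y => h' (β.symm y)) fun x y hx hy hxy =>
    hh (α.symm x) (β.symm y) (by simpa using hx) (by simpa using hy) (by simpa using hxy)
  rw [← Equiv.sum_comp α f, ← Equiv.sum_comp β g,
    ← Equiv.sum_comp α fun x => f x * h (α.symm x),
    ← Equiv.sum_comp β fun y => g y * h' (β.symm y)] at this
  simpa using this

/-- The tower property: averaging a conditional expectation given χ recovers the expectation. Null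
fibres, where the quotient is 0 by convention, carry no weight. -/
theorem _root_.sum_mul_fiberwise_average {Z K : Type*} [Fintype Z] [DecidableEq K] (χ : Z → K) (k h : Z → ℝ)
    (hk : ∀ z, 0 ≤ k z) :
    ∑ z, k z * ((∑ z', (if χ z' = χ z then k z' else 0) * h z') /
      ∑ z', if χ z' = χ z then k z' else 0) = ∑ z, k z * h z := by
  simp_rw [Finset.sum_div, Finset.mul_sum]
  rw [Finset.sum_comm]
  refine Finset.sum_congr rfl fun z' _ => ?_
  by_cases hz : k z' = 0
  · simp [hz]
  have hpos : (∑ z, if χ z = χ z' then k z else 0) ≠ 0 := by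
    refine (Finset.sum_pos' (fun z _ => ?_) ⟨z', Finset.mem_univ _, ?_⟩).ne'
    · split_ifs
      · exact hk z
      · exact le_rfl
    · rw [if_pos rfl]; exact lt_of_le_of_ne (hk z') (Ne.symm hz)
  calc _ = ∑ z, (if χ z = χ z' then k z else 0) *
        (k z' * h z' / ∑ z, if χ z = χ z' then k z else 0) := by
        refine Finset.sum_congr rfl fun z _ => ?_
        by_cases hχ : χ z = χ z'
        · rw [if_pos hχ, if_pos hχ.symm, hχ]
        · rw [if_neg hχ, if_neg (Ne.symm hχ)]; simp
    _ = _ := by rw [← Finset.sum_mul]; field_simp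

/-- Couplings of two image measures and of the corresponding conditional measures can be
composed. -/
theorem glue {I J : Type*} [DecidableEq I] [DecidableEq J] (φ : X → I) (ψ : Y → J) (hf : ∀ x, 0 ≤ f x) (hg : ∀ y, 0 ≤ g y)
    (R₁ : I → J → Prop)
    (hbase : ∀ (H : I → ℝ) (H' : J → ℝ),
      (∀ x y, f x ≠ 0 → g y ≠ 0 → R₁ (φ x) (ψ y) → H' (ψ y) ≤ H (φ x)) →
        (∑ y, g y * H' (ψ y)) * ∑ x, f x ≤ (∑ x, f x * H (φ x)) * ∑ y, g y)
    (hfib : ∀ i j, R₁ i j → Dominates R (fun x => if φ x = i then f x else 0)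
      (fun y => if ψ y = j then g y else 0)) : Dominates R f g := by
  intro h h' hh
  -- The test functions on the base are the conditional expectations of h and h' on the fibres.
  have := hbase
    (fun i => (∑ x, (if φ x = i then f x else 0) * h x) / ∑ x, if φ x = i then f x else 0)
    (fun j => (∑ y, (if ψ y = j then g y else 0) * h' y) / ∑ y, if ψ y = j then g y else 0)
    (fun x y hx hy hxy => by
      have h1 : 0 < ∑ x', if φ x' = φ x then f x' else 0 := by
        refine Finset.sum_pos' (fun z _ => ?_) ⟨x, Finset.mem_univ _, ?_⟩
        · split_ifs
          · exact hf z
          · exact le_rfl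
        · rw [if_pos rfl]; exact lt_of_le_of_ne (hf x) (Ne.symm hx)
      have h2 : 0 < ∑ y', if ψ y' = ψ y then g y' else 0 := by
        refine Finset.sum_pos' (fun z _ => ?_) ⟨y, Finset.mem_univ _, ?_⟩
        · split_ifs
          · exact hg z
          · exact le_rfl
        · rw [if_pos rfl]; exact lt_of_le_of_ne (hg y) (Ne.symm hy)
      rw [div_le_div_iff₀ h2 h1]
      refine hfib _ _ hxy h h' fun x' y' hx' hy' hr => hh x' y' ?_ ?_ hr
      · intro h0; exact hx' (by simp [h0])
      · intro h0; exact hy' (by simp [h0]))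
  rwa [sum_mul_fiberwise_average ψ g h' hg, sum_mul_fiberwise_average φ f h hf] at this

end Dominates

set_option linter.unusedSectionVars false

/-! ### Ranks, level sums and product cubes. -/

section Rank

variable {E F : Type u} [Fintype E] [Fintype F] [DecidableEq E] [DecidableEq F]

theorem boolRank_mono {x y : E → Bool} (h : y ≤ x) : boolRank y ≤ boolRank x := by
  refine Finset.card_le_card fun e he => ?_
  simp only [Finset.mem_filter, Finset.mem_univ, true_and] at he ⊢
  have := h e
  rw [he] at this
  exact top_le_iff.1 this

theorem boolRank_le_succ {x y : E → Bool} {d : E} (h : ∀ e, e ≠ d → y e ≤ x e) :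
    boolRank y ≤ boolRank x + 1 := by
  refine (Finset.card_le_card (t := insert d (Finset.univ.filter fun e => x e = true))
    fun e he => ?_).trans (Finset.card_insert_le _ _)
  simp only [Finset.mem_filter, Finset.mem_univ, true_and, Finset.mem_insert] at he ⊢
  by_cases hd : e = d
  · exact Or.inl hd
  · have := h e hd
    rw [he] at this
    exact Or.inr (top_le_iff.1 this)

theorem boolRank_sum (x : E ⊕ F → Bool) :
    boolRank x = boolRank (fun e => x (Sum.inl e)) + boolRank (fun f => x (Sum.inr f)) := by
  simp only [boolRank, Finset.card_filter, Fintype.sum_sum_type]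

theorem boolRank_elim (x : E → Bool) (y : F → Bool) :
    boolRank (Sum.elim x y) = boolRank x + boolRank y := boolRank_sum _

theorem boolRank_comp_equiv (e : E ≃ F) (y : F → Bool) :
    boolRank (fun i => y (e i)) = boolRank y := by
  simp only [boolRank, Finset.card_filter]
  exact Equiv.sum_comp e fun f => if y f = true then 1 else 0

theorem sum_elim_le_iff {x x' : E → Bool} {y y' : F → Bool} :
    Sum.elim x y ≤ Sum.elim x' y' ↔ x ≤ x' ∧ y ≤ y' := by
  simp [Pi.le_def]

theorem sum_cube_sum (G : (E ⊕ F → Bool) → ℝ) :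
    ∑ z, G z = ∑ x : E → Bool, ∑ y : F → Bool, G (Sum.elim x y) := by
  rw [← Fintype.sum_prod_type' (f := fun x y => G (Sum.elim x y))]
  exact Fintype.sum_equiv (Equiv.sumArrowEquivProdArrow E F Bool) _ _ fun z => by
    congr 1; ext (i | i) <;> rfl

theorem sum_cube_comp_equiv (e : E ≃ F) (G : (E → Bool) → ℝ) :
    ∑ y : F → Bool, G (fun i => y (e i)) = ∑ x, G x :=
  Fintype.sum_equiv (e.symm.arrowCongr (Equiv.refl Bool)) _ _ fun _ => rfl

/-- The total weight of the configurations of rank `k`. -/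
noncomputable def levelSum (u : (E → Bool) → ℝ) (k : ℕ) : ℝ :=
  ∑ x, if boolRank x = k then u x else 0

theorem sum_mul_boolRank (u : (E → Bool) → ℝ) (G : ℕ → ℝ) :
    ∑ x, u x * G (boolRank x) =
      ∑ k ∈ Finset.range (Fintype.card E + 1), levelSum u k * G k := by
  simp_rw [levelSum, Finset.sum_mul]
  rw [Finset.sum_comm]
  refine Finset.sum_congr rfl fun x _ => ?_
  simp_rw [ite_mul, zero_mul]
  rw [Finset.sum_ite_eq, if_pos (Finset.mem_range.2 (Nat.lt_succ_of_le
    (BoolMeasure.boolRank_le_card x)))]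

theorem levelSum_eq_zero (u : (E → Bool) → ℝ) {k : ℕ} (hk : Fintype.card E < k) :
    levelSum u k = 0 :=
  Finset.sum_eq_zero fun x _ => if_neg (by have := BoolMeasure.boolRank_le_card x; omega)

theorem exists_of_levelSum_ne_zero {u : (E → Bool) → ℝ} {k : ℕ} (h : levelSum u k ≠ 0) :
    ∃ x, boolRank x = k ∧ u x ≠ 0 := by
  obtain ⟨x, -, hx⟩ := Finset.exists_ne_zero_of_sum_ne_zero h
  exact ⟨x, by simpa using hx⟩

/-- The weight of the product of two measures. -/
def prodWeight (u : (E → Bool) → ℝ) (v : (F → Bool) → ℝ) (x : E ⊕ F → Bool) : ℝ :=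
  u (fun e => x (Sum.inl e)) * v (fun f => x (Sum.inr f))

@[simp] theorem prodWeight_elim (u : (E → Bool) → ℝ) (v : (F → Bool) → ℝ) (x : E → Bool)
    (y : F → Bool) : prodWeight u v (Sum.elim x y) = u x * v y := rfl

theorem levelSum_prodWeight (u : (E → Bool) → ℝ) (v : (F → Bool) → ℝ) :
    levelSum (prodWeight u v) = IsPF2.conv (levelSum u) (levelSum v) := by
  ext k
  rw [levelSum, sum_cube_sum]
  simp_rw [boolRank_elim, prodWeight_elim]
  have h1 : ∀ x : E → Bool, (∑ y : F → Bool, if boolRank x + boolRank y = k then u x * v y else 0) =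
      u x * if boolRank x ≤ k then levelSum v (k - boolRank x) else 0 := fun x => by
    split_ifs with h
    · rw [levelSum, Finset.mul_sum]
      refine Finset.sum_congr rfl fun y _ => ?_
      rw [mul_ite, mul_zero]
      exact if_congr (by omega) rfl rfl
    · rw [mul_zero]
      exact Finset.sum_eq_zero fun y _ => if_neg (by omega)
  simp_rw [h1]
  refine (sum_mul_boolRank u fun i => if i ≤ k then levelSum v (k - i) else 0).trans ?_
  rw [IsPF2.conv]
  rcases le_total (Fintype.card E) k with h | h
  · refine (Finset.sum_congr rfl fun i hi => ?_).trans (Finset.sum_subset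
      (Finset.range_subset_range.2 (by omega)) fun i _ hi => ?_)
    · have := Finset.mem_range.1 hi
      rw [if_pos (by omega)]
    · rw [Finset.mem_range] at hi
      rw [levelSum_eq_zero u (by omega), zero_mul]
  · symm
    refine (Finset.sum_congr rfl fun i hi => ?_).trans (Finset.sum_subset
      (Finset.range_subset_range.2 (by omega)) fun i _ hi => ?_)
    · have := Finset.mem_range.1 hi
      rw [if_pos (by omega)]
    · rw [Finset.mem_range] at hi
      rw [if_neg (by omega), mul_zero]

/-- This is `Dominates.glue` along the first factor: couple the marginals on E, then the conditional
laws on F. -/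
theorem Dominates.prod_glue {R : (E ⊕ F → Bool) → (E ⊕ F → Bool) → Prop}
    {R₁ : (E → Bool) → (E → Bool) → Prop} {f g : (E ⊕ F → Bool) → ℝ} (hf : ∀ x, 0 ≤ f x)
    (hg : ∀ x, 0 ≤ g x)
    (hbase : Dominates R₁ (fun x => ∑ z, f (Sum.elim x z)) (fun y => ∑ z, g (Sum.elim y z)))
    (hfib : ∀ x y, R₁ x y → Dominates (fun z z' => R (Sum.elim x z) (Sum.elim y z'))
      (fun z => f (Sum.elim x z)) (fun z' => g (Sum.elim y z'))) : Dominates R f g := by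
  have fib : ∀ (k : (E ⊕ F → Bool) → ℝ) (x : E → Bool),
      ∑ z, (if (fun e => z (Sum.inl e)) = x then k z else 0) = ∑ z, k (Sum.elim x z) := by
    intro k x
    rw [sum_cube_sum]
    change ∑ a, ∑ b, (if a = x then k (Sum.elim a b) else 0) = _
    rw [Finset.sum_comm]
    simp
  refine Dominates.glue (fun x e => x (Sum.inl e)) (fun y e => y (Sum.inl e)) hf hg R₁ ?_ ?_
  · intro H H' hH
    simp only [sum_cube_sum, Sum.elim_inl, ← Finset.sum_mul]
    refine hbase H H' fun x y hx hy hxy => ?_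
    obtain ⟨z, -, hz⟩ := Finset.exists_ne_zero_of_sum_ne_zero hx
    obtain ⟨z', -, hz'⟩ := Finset.exists_ne_zero_of_sum_ne_zero hy
    exact hH _ _ hz hz' hxy
  · intro x y hxy h h' hh
    simp only [ite_mul, zero_mul]
    rw [fib f, fib g, fib (fun z => f z * h z), fib (fun z => g z * h' z)]
    exact hfib x y hxy (fun z => h (Sum.elim x z)) (fun z => h' (Sum.elim y z))
      fun z z' hz hz' hr => hh _ _ (by simpa using hz) (by simpa using hz') hr

end Rank

/-! ### Rank monotonicity and the flip property. -/

section RankMonotone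

variable {E F : Type u} [Fintype E] [Fintype F] [DecidableEq E] [DecidableEq F]

/-- The rank sequence of `u` is log-concave and the law conditioned on the rank increases with
the rank. -/
structure RankMonotone (u : (E → Bool) → ℝ) : Prop where
  nonneg : ∀ x, 0 ≤ u x
  isPF2 : IsPF2 (levelSum u)
  dominates : ∀ k, Dominates (fun x y => y ≤ x) (fun x => if boolRank x = k + 1 then u x else 0)
    (fun y => if boolRank y = k then u y else 0)

namespace RankMonotone

variable {u : (E → Bool) → ℝ} {v : (F → Bool) → ℝ}

/-- Log-concavity of q lowers the rank under the shifted tilt, and log-concavity of the rank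
sequence of u bounds the drop by one. So the ranks couple with difference 0 or 1; given the ranks,
use the diagonal coupling or `hu.dominates`. -/
theorem dominates_shift (hu : RankMonotone u) {q : ℕ → ℝ} (hq : IsPF2 q) :
    Dominates (fun x y => y ≤ x ∧ boolRank x ≤ boolRank y + 1) (fun x => u x * q (boolRank x))
      (fun y => u y * q (boolRank y + 1)) := by
  have lnn := hu.isPF2.nonneg
  refine Dominates.glue boolRank boolRank (fun x => mul_nonneg (hu.nonneg x) (hq.nonneg _))
    (fun x => mul_nonneg (hu.nonneg x) (hq.nonneg _)) (fun k l => k = l ∨ k = l + 1) ?_ ?_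
  · intro H H' hH
    rw [sum_mul_boolRank u q, sum_mul_boolRank u fun k => q (k + 1)]
    simp only [mul_assoc]
    rw [sum_mul_boolRank u fun k => q k * H k, sum_mul_boolRank u fun k => q (k + 1) * H' k]
    simp only [← mul_assoc]
    refine sum_range_mul_le_of_interlacing (a := fun k => levelSum u k * q k)
      (b := fun k => levelSum u k * q (k + 1)) (fun k => mul_nonneg (lnn k) (hq.nonneg _))
      (fun k => mul_nonneg (lnn k) (hq.nonneg _)) ?_ (fun i j hij => ?_) (fun i j hij => ?_)
      (fun k ha hb => ?_) (fun k ha hb => ?_)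
    · rw [levelSum_eq_zero u (Nat.lt_succ_self _), zero_mul]
    · have := mul_le_mul_of_nonneg_left (hq.mul_le i j 1 hij) (mul_nonneg (lnn i) (lnn j))
      linarith
    · have := mul_le_mul_of_nonneg_left (hu.isPF2.mul_le i j 1 hij)
        (mul_nonneg (hq.nonneg (i + 1)) (hq.nonneg (j + 1)))
      linarith
    · obtain ⟨x, rfl, hx⟩ := exists_of_levelSum_ne_zero (left_ne_zero_of_mul ha)
      exact hH x x (mul_ne_zero hx (right_ne_zero_of_mul ha))
        (mul_ne_zero hx (right_ne_zero_of_mul hb)) (Or.inl rfl)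
    · obtain ⟨x, hxk, hx⟩ := exists_of_levelSum_ne_zero (left_ne_zero_of_mul ha)
      obtain ⟨y, rfl, hy⟩ := exists_of_levelSum_ne_zero (left_ne_zero_of_mul hb)
      have := hH x y (mul_ne_zero hx (by rw [hxk]; exact right_ne_zero_of_mul ha))
        (mul_ne_zero hy (right_ne_zero_of_mul hb)) (Or.inr hxk)
      rwa [hxk] at this
  · have e : ∀ (p : ℕ → ℝ) (k : ℕ), (fun x : E → Bool => if boolRank x = k then
        u x * p (boolRank x) else 0) = fun x => p k * if boolRank x = k then u x else 0 := by
      intro p k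
      ext x
      split_ifs with h
      · rw [h, mul_comm]
      · rw [mul_zero]
    rintro k l hkl
    have key : Dominates (fun x y => y ≤ x ∧ boolRank x ≤ boolRank y + 1)
        (fun x => q k * if boolRank x = k then u x else 0)
        (fun y => q (l + 1) * if boolRank y = l then u y else 0) := by
      refine Dominates.smul ?_ (hq.nonneg _) (hq.nonneg _)
      rcases hkl with rfl | rfl
      · refine Dominates.refl (fun x => ?_) fun x => ⟨le_rfl, Nat.le_succ _⟩
        split_ifs
        · exact hu.nonneg x
        · exact le_rfl
      · refine (hu.dominates l).mono fun x y hx hy hxy => ⟨hxy, ?_⟩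
        have h1 : boolRank x = l + 1 := by by_contra h; exact hx (if_neg h)
        have h2 : boolRank y = l := by by_contra h; exact hy (if_neg h)
        omega
    rw [← e q, ← e fun k => q (k + 1)] at key
    convert key using 5

theorem prod (hu : RankMonotone u) (hv : RankMonotone v) : RankMonotone (prodWeight u v) where
  nonneg x := mul_nonneg (hu.nonneg _) (hv.nonneg _)
  isPF2 := by rw [levelSum_prodWeight]; exact hu.isPF2.isPF2_conv hv.isPF2
  dominates k := by
    have nn : ∀ k (x : E ⊕ F → Bool), 0 ≤ if boolRank x = k then prodWeight u v x else 0 := by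
      intro k x
      split_ifs
      · exact mul_nonneg (hu.nonneg _) (hv.nonneg _)
      · exact le_rfl
    have marg : ∀ (k : ℕ) (x : E → Bool),
        (∑ z : F → Bool, if boolRank (Sum.elim x z) = k then prodWeight u v (Sum.elim x z) else 0) =
        u x * if boolRank x ≤ k then levelSum v (k - boolRank x) else 0 := by
      intro k x
      simp_rw [boolRank_elim, prodWeight_elim]
      split_ifs with h
      · rw [levelSum, Finset.mul_sum]
        refine Finset.sum_congr rfl fun y _ => ?_
        rw [mul_ite, mul_zero]
        exact if_congr (by omega) rfl rfl
      · rw [mul_zero]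
        exact Finset.sum_eq_zero fun y _ => if_neg (by omega)
    refine Dominates.prod_glue (nn _) (nn _)
      (R₁ := fun x y => y ≤ x ∧ boolRank x ≤ boolRank y + 1) ?_ ?_
    -- Since k - r = (k + 1) - (r + 1), both marginals on E come from the same reversed level
    -- sequence of v, the second shifted by one.
    · have h2 : (fun y => u y * if boolRank y ≤ k then levelSum v (k - boolRank y) else 0) =
          fun y => u y * (fun i => if i ≤ k + 1 then levelSum v (k + 1 - i) else 0)
            (boolRank y + 1) := by
        ext y
        simp only [Nat.add_sub_add_right, Nat.add_le_add_iff_right]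
      simp_rw [marg]
      rw [h2]
      exact hu.dominates_shift (hv.isPF2.reverse (k + 1))
    · rintro x y ⟨hxy, hr⟩
      have fib : ∀ (k : ℕ) (x : E → Bool), (fun z : F → Bool =>
          if boolRank (Sum.elim x z) = k then prodWeight u v (Sum.elim x z) else 0) =
          fun z => u x * if boolRank x + boolRank z = k then v z else 0 := by
        intro k x
        ext z
        rw [boolRank_elim, prodWeight_elim, mul_ite, mul_zero]
      rw [fib, fib]
      refine Dominates.smul ?_ (hu.nonneg x) (hu.nonneg y)
      have hyx := boolRank_mono hxy
      simp_rw [sum_elim_le_iff]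
      by_cases hy : boolRank y ≤ k
      swap
      · refine Dominates.of_forall (fun z => ?_) (fun z => ?_) fun z z' _ hz' =>
          absurd (if_neg (by omega)) hz'
        · split_ifs
          exacts [hv.nonneg z, le_rfl]
        · split_ifs
          exacts [hv.nonneg z, le_rfl]
      -- If the first factor already absorbs the extra unit of rank, the second factors have the
      -- same law; otherwise the second must absorb it, by its own rank monotonicity.
      rcases (show boolRank x = boolRank y + 1 ∨ boolRank x = boolRank y by omega) with h | h
      · have : (fun z : F → Bool => if boolRank x + boolRank z = k + 1 then v z else 0) =
            fun z => if boolRank y + boolRank z = k then v z else 0 := by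
          ext z
          exact if_congr (by omega) rfl rfl
        rw [this]
        refine Dominates.refl (fun z => ?_) fun z => ⟨hxy, le_rfl⟩
        split_ifs
        exacts [hv.nonneg z, le_rfl]
      · have h1 : (fun z : F → Bool => if boolRank x + boolRank z = k + 1 then v z else 0) =
            fun z => if boolRank z = k - boolRank y + 1 then v z else 0 := by
          ext z
          exact if_congr (by omega) rfl rfl
        have h2 : (fun z : F → Bool => if boolRank y + boolRank z = k then v z else 0) =
            fun z => if boolRank z = k - boolRank y then v z else 0 := by
          ext z
          exact if_congr (by omega) rfl rfl
        rw [h1, h2]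
        exact (hv.dominates _).mono fun _ _ _ _ h => ⟨hxy, h⟩

/-- Rescaling multiplies the rank sequence by p and leaves the laws conditioned on the rank
unchanged up to constants. -/
theorem rescale (hu : RankMonotone u) {p : ℕ → ℝ} (hp : IsPF2 p) :
    RankMonotone fun x => p (boolRank x) * u x where
  nonneg x := mul_nonneg (hp.nonneg _) (hu.nonneg x)
  isPF2 := by
    convert hp.mul hu.isPF2 using 2 with k
    rw [levelSum, levelSum, Finset.mul_sum]
    refine Finset.sum_congr rfl fun x _ => ?_
    split_ifs with h
    · rw [h]
    · rw [mul_zero]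
  dominates k := by
    convert (hu.dominates k).smul (hp.nonneg (k + 1)) (hp.nonneg k) using 2 with x x
    · split_ifs with h
      · rw [h]
      · rw [mul_zero]
    · split_ifs with h
      · rw [h]
      · rw [mul_zero]

theorem relabel (hu : RankMonotone u) (e : E ≃ F) :
    RankMonotone fun y : F → Bool => u fun i => y (e i) where
  nonneg y := hu.nonneg _
  isPF2 := by
    convert hu.isPF2 using 1
    ext k
    rw [levelSum, levelSum, ← sum_cube_comp_equiv e]
    simp_rw [boolRank_comp_equiv]
  dominates k := by
    have := (hu.dominates k).comp_equiv (e.symm.arrowCongr (Equiv.refl Bool))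
      (e.symm.arrowCongr (Equiv.refl Bool))
    change Dominates (fun x y : F → Bool => (fun i => y (e i)) ≤ fun i => x (e i))
      (fun y => if boolRank (fun i => y (e i)) = k + 1 then u (fun i => y (e i)) else 0)
      (fun y => if boolRank (fun i => y (e i)) = k then u (fun i => y (e i)) else 0) at this
    simp_rw [boolRank_comp_equiv] at this
    convert this.mono (R' := fun x y => y ≤ x) fun x y _ _ h f => ?_
    simpa using h (e.symm f)

end RankMonotone

/-- For every log-concave rank rescaling, the law given `X_d = 0` covers the law given
`X_d = 1`. -/
def FlipDominates (d : E) (u : (E → Bool) → ℝ) : Prop :=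
  ∀ q : ℕ → ℝ, IsPF2 q →
    Dominates (fun x y => (∀ e, e ≠ d → y e ≤ x e) ∧ boolRank x ≤ boolRank y)
      (fun x => if x d = false then u x * q (boolRank x) else 0)
      (fun y => if y d = true then u y * q (boolRank y) else 0)

namespace FlipDominates

variable {u : (E → Bool) → ℝ} {v : (F → Bool) → ℝ} {d : E}

theorem rescale (hu : FlipDominates d u) {p : ℕ → ℝ} (hp : IsPF2 p) :
    FlipDominates d fun x => p (boolRank x) * u x := by
  intro q hq
  have := hu _ (hp.mul hq)
  simp only [mul_comm, mul_left_comm] at this ⊢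
  exact this

theorem relabel (hu : FlipDominates d u) (e : E ≃ F) :
    FlipDominates (e d) fun y : F → Bool => u fun i => y (e i) := by
  intro q hq
  have := (hu q hq).comp_equiv (e.symm.arrowCongr (Equiv.refl Bool))
      (e.symm.arrowCongr (Equiv.refl Bool))
  change Dominates (fun x y : F → Bool => (∀ i, i ≠ d → y (e i) ≤ x (e i)) ∧
      boolRank (fun i => x (e i)) ≤ boolRank fun i => y (e i))
    (fun y => if y (e d) = false then u (fun i => y (e i)) * q (boolRank fun i => y (e i)) else 0)
    (fun y => if y (e d) = true then u (fun i => y (e i)) * q (boolRank fun i => y (e i)) else 0)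
    at this
  simp_rw [boolRank_comp_equiv] at this
  convert this.mono (R' := fun x y => (∀ f, f ≠ e d → y f ≤ x f) ∧ boolRank x ≤ boolRank y)
    fun x y _ _ h => ⟨fun f hf => ?_, h.2⟩
  simpa using h.1 (e.symm f) (by rintro rfl; simp at hf)

/-- The marginal on E is u rescaled by the correlation of q with the level sums of v, again
log-concave, so the flip property of u applies. Given x and y, the laws on F are tilts of v by
shifts of q that agree or differ by one step. -/
theorem prod_left (hu : ∀ x, 0 ≤ u x) (hd : FlipDominates d u) (hv : RankMonotone v) :
    FlipDominates (Sum.inl d) (prodWeight u v) := by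
  intro q hq
  have nn : ∀ b (x : E ⊕ F → Bool),
      0 ≤ if x (Sum.inl d) = b then prodWeight u v x * q (boolRank x) else 0 := by
    intro b x
    split_ifs
    · exact mul_nonneg (mul_nonneg (hu _) (hv.nonneg _)) (hq.nonneg _)
    · exact le_rfl
  have marg : ∀ (b : Bool) (x : E → Bool),
      (∑ z : F → Bool, if Sum.elim x z (Sum.inl d) = b then
        prodWeight u v (Sum.elim x z) * q (boolRank (Sum.elim x z)) else 0) =
      if x d = b then u x * ∑ j ∈ Finset.range (Fintype.card F + 1),
        levelSum v j * q (boolRank x + j) else 0 := by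
    intro b x
    simp_rw [boolRank_elim, prodWeight_elim, Sum.elim_inl]
    by_cases h : x d = b
    · rw [if_pos h, ← sum_mul_boolRank v fun j => q (boolRank x + j), Finset.mul_sum]
      exact Finset.sum_congr rfl fun z _ => (if_pos h).trans (mul_assoc _ _ _)
    · rw [if_neg h]
      exact Finset.sum_eq_zero fun z _ => if_neg h
  have fib : ∀ (b : Bool) (x : E → Bool), (fun z : F → Bool =>
      if Sum.elim x z (Sum.inl d) = b then
        prodWeight u v (Sum.elim x z) * q (boolRank (Sum.elim x z)) else 0) =
      fun z => (if x d = b then u x else 0) * (v z * q (boolRank x + boolRank z)) := by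
    intro b x
    ext z
    rw [boolRank_elim, prodWeight_elim, Sum.elim_inl, ite_mul, zero_mul, mul_assoc]
  refine Dominates.prod_glue (nn _) (nn _)
    (R₁ := fun x y => (∀ e, e ≠ d → y e ≤ x e) ∧ boolRank x ≤ boolRank y) ?_ ?_
  · simp_rw [marg]
    exact hd _ (hv.isPF2.correlation hq _)
  · rintro x y ⟨hxy, hr⟩
    rw [fib, fib]
    have hyx := boolRank_le_succ hxy
    have unn : ∀ b (x : E → Bool), 0 ≤ if x d = b then u x else 0 := by
      intro b x
      split_ifs
      exacts [hu x, le_rfl]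
    refine Dominates.smul ?_ (unn _ _) (unn _ _)
    have key : ∀ z z' : F → Bool, z' ≤ z →
        (∀ e, e ≠ Sum.inl d → Sum.elim y z' e ≤ Sum.elim x z e) := by
      rintro z z' hz (e | f) he
      · exact hxy e fun h => he (h ▸ rfl)
      · exact hz f
    rcases (show boolRank y = boolRank x ∨ boolRank y = boolRank x + 1 by omega) with h | h
    · rw [h]
      refine Dominates.refl (fun z => mul_nonneg (hv.nonneg z) (hq.nonneg _)) fun z =>
        ⟨key z z le_rfl, ?_⟩
      rw [boolRank_elim, boolRank_elim, h]
    -- Here y has one more unit of rank than x on E, so the slack of one between z and z' still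
    -- leaves the total rank of x at most that of y.
    · have h1 := hv.dominates_shift (hq.shift (boolRank x))
      rw [h]
      simp only [add_right_comm _ 1 _]
      simp only [← add_assoc] at h1
      refine h1.mono fun z z' _ _ hz => ⟨key z z' hz.1, ?_⟩
      rw [boolRank_elim, boolRank_elim]
      omega

theorem prod_right {d : F} (hv : ∀ x, 0 ≤ v x) (hd : FlipDominates d v) (hu : RankMonotone u) :
    FlipDominates (Sum.inr d) (prodWeight u v) := by
  have h : prodWeight u v = fun y => prodWeight v u fun i => y (Equiv.sumComm F E i) := by
    ext y
    exact mul_comm _ _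
  rw [h]
  exact (prod_left hv hd hu).relabel (Equiv.sumComm F E)

end FlipDominates

end RankMonotone

/-! ### Covering weights and regression for positive weights. -/

section Covering

variable {E F : Type u} [Fintype E] [Fintype F] [DecidableEq E] [DecidableEq F]

/-- A positive weight such that, under every external field (possibly fixing coordinates), ranks
are monotone and the law given `X_d = 0` covers the law given `X_d = 1`. -/
structure IsCovering (w : (E → Bool) → ℝ) : Prop where
  pos : ∀ x, 0 < w x
  rankMonotone : ∀ θ : E → Bool → ℝ, (∀ e b, 0 ≤ θ e b) →
    RankMonotone fun x => w x * ∏ e, θ e (x e)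
  flipDominates : ∀ θ : E → Bool → ℝ, (∀ e b, 0 ≤ θ e b) → ∀ d,
    FlipDominates d fun x => w x * ∏ e, θ e (x e)

namespace IsCovering

variable {w : (E → Bool) → ℝ} {v : (F → Bool) → ℝ}

theorem prod (hw : IsCovering w) (hv : IsCovering v) : IsCovering (prodWeight w v) := by
  have split : ∀ θ : E ⊕ F → Bool → ℝ, (fun x => prodWeight w v x * ∏ e, θ e (x e)) =
      prodWeight (fun x => w x * ∏ e, θ (Sum.inl e) (x e))
        (fun x => v x * ∏ f, θ (Sum.inr f) (x f)) := by
    intro θ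
    ext x
    simp only [prodWeight, Fintype.prod_sum_type]
    ring
  refine ⟨fun x => mul_pos (hw.pos _) (hv.pos _), fun θ hθ => ?_, fun θ hθ d => ?_⟩
  · rw [split]
    exact (hw.rankMonotone _ fun e => hθ _).prod (hv.rankMonotone _ fun e => hθ _)
  · rw [split]
    have h1 := hw.rankMonotone _ fun e => hθ (Sum.inl e)
    have h2 := hv.rankMonotone _ fun e => hθ (Sum.inr e)
    rcases d with d | d
    · exact FlipDominates.prod_left h1.nonneg (hw.flipDominates _ (fun e => hθ _) d) h2
    · exact FlipDominates.prod_right h2.nonneg (hv.flipDominates _ (fun e => hθ _) d) h1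

theorem relabel (hw : IsCovering w) (e : E ≃ F) :
    IsCovering fun y : F → Bool => w fun i => y (e i) := by
  have split : ∀ θ : F → Bool → ℝ,
      (fun y : F → Bool => (w fun i => y (e i)) * ∏ f, θ f (y f)) =
      fun y => (fun x => w x * ∏ i, θ (e i) (x i)) fun i => y (e i) := by
    intro θ
    ext y
    rw [← Equiv.prod_comp e]
  refine ⟨fun x => hw.pos _, fun θ hθ => ?_, fun θ hθ d => ?_⟩
  · rw [split]
    exact (hw.rankMonotone _ fun i => hθ (e i)).relabel e
  · rw [split]
    obtain ⟨d, rfl⟩ := e.surjective d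
    exact (hw.flipDominates _ (fun i => hθ (e i)) d).relabel e

theorem field (hw : IsCovering w) {W : E → ℝ} (hW : ∀ e, 0 < W e) :
    IsCovering fun x => (∏ e, if x e = true then W e else 1) * w x := by
  have hW' : ∀ e (b : Bool), 0 < if b = true then W e else 1 := by
    intro e b
    split_ifs
    exacts [hW e, one_pos]
  have split : ∀ θ : E → Bool → ℝ,
      (fun x => (∏ e, if x e = true then W e else 1) * w x * ∏ e, θ e (x e)) =
      fun x => w x * ∏ e, (fun e b => (if b = true then W e else 1) * θ e b) e (x e) := by
    intro θ
    ext x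
    rw [Finset.prod_mul_distrib]
    ring
  have hθ' : ∀ θ : E → Bool → ℝ, (∀ e b, 0 ≤ θ e b) →
      ∀ e (b : Bool), 0 ≤ (if b = true then W e else 1) * θ e b :=
    fun θ hθ e b => mul_nonneg (hW' e b).le (hθ e b)
  refine ⟨fun x => mul_pos (Finset.prod_pos fun e _ => hW' e (x e)) (hw.pos x),
    fun θ hθ => ?_, fun θ hθ d => ?_⟩
  · rw [split]
    exact hw.rankMonotone _ (hθ' θ hθ)
  · rw [split]
    exact hw.flipDominates _ (hθ' θ hθ) d

theorem rescale (hw : IsCovering w) {p : ℕ → ℝ} (hp : IsPF2 p) (hp0 : ∀ k, 0 < p k) :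
    IsCovering fun x => p (boolRank x) * w x := by
  refine ⟨fun x => mul_pos (hp0 _) (hw.pos x), fun θ hθ => ?_, fun θ hθ d => ?_⟩
  · simp only [mul_assoc]
    exact (hw.rankMonotone θ hθ).rescale hp
  · simp only [mul_assoc]
    exact (hw.flipDominates θ hθ d).rescale hp

/-- With one coordinate, each law conditioned on the rank or on the coordinate sits at a single
point, so independent couplings suffice. -/
theorem single {w : (PUnit.{u + 1} → Bool) → ℝ} (hw : ∀ x, 0 < w x) : IsCovering w := by
  have nn : ∀ θ : PUnit.{u + 1} → Bool → ℝ, (∀ e b, 0 ≤ θ e b) →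
      ∀ x, 0 ≤ w x * ∏ e, θ e (x e) :=
    fun θ hθ x => mul_nonneg (hw x).le (Finset.prod_nonneg fun e _ => hθ _ _)
  have rank : ∀ x : PUnit.{u + 1} → Bool, boolRank x = if x PUnit.unit = true then 1 else 0 := by
    intro x
    rw [boolRank, Finset.card_filter]
    exact Fintype.sum_unique _
  refine ⟨hw, fun θ hθ => ⟨nn θ hθ, ⟨fun k => Finset.sum_nonneg fun x _ => ?_, ?_⟩, fun k => ?_⟩,
    fun θ hθ d q hq => ?_⟩
  · split_ifs
    exacts [nn θ hθ x, le_rfl]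
  · intro a b m hab
    have lnn : ∀ k, 0 ≤ levelSum (fun x => w x * ∏ e, θ e (x e)) k :=
      fun k => Finset.sum_nonneg fun x _ => by
        split_ifs
        exacts [nn θ hθ x, le_rfl]
    by_cases h : 1 < b + m
    · rw [levelSum_eq_zero _ (k := b + m) (by simpa using h), mul_zero]
      exact mul_nonneg (lnn _) (lnn _)
    · obtain ⟨rfl, rfl⟩ | rfl | rfl : (a = 0 ∧ b = 0) ∨ m = 0 ∨ a = b := by omega
      · exact (mul_comm _ _).le
      · exact le_rfl
      · exact (mul_comm _ _).le
  · refine Dominates.of_forall (fun x => ?_) (fun x => ?_) fun x y hx hy => ?_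
    · split_ifs
      exacts [nn θ hθ x, le_rfl]
    · split_ifs
      exacts [nn θ hθ x, le_rfl]
    · have h1 : boolRank x = k + 1 := by by_contra h; exact hx (if_neg h)
      rw [rank] at h1
      rintro ⟨⟩
      split_ifs at h1 with h
      rw [h]; exact le_top
  · refine Dominates.of_forall (fun x => ?_) (fun x => ?_) fun x y hx hy => ⟨fun e he => ?_, ?_⟩
    · split_ifs
      exacts [mul_nonneg (nn θ hθ x) (hq.nonneg _), le_rfl]
    · split_ifs
      exacts [mul_nonneg (nn θ hθ x) (hq.nonneg _), le_rfl]
    · exact absurd (Subsingleton.elim _ _) he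
    · have h1 : x d = false := by by_contra h; exact hx (if_neg h)
      rw [rank x, if_neg (by rw [show PUnit.unit = d from rfl, h1]; simp)]
      exact Nat.zero_le _

/-- The sum of `w * h` over the configurations that agree with `c` outside `A`. -/
def _root_.fiberSum (A : Finset E) (w h : (E → Bool) → ℝ) (c : E → Bool) : ℝ :=
  ∑ x, if ∀ e, e ∉ A → x e = c e then w x * h x else 0

/-- The flip property at d with constant rescaling, under the field freezing every coordinate
outside A ∪ {d} to its value in c. Since d ∉ A, h ignores the flipped coordinate. -/
theorem fiberSum_update_le (hw : IsCovering w) (A : Finset E) {h : (E → Bool) → ℝ}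
    (hh : ∀ x y : E → Bool, (∀ e ∈ A, y e ≤ x e) → h y ≤ h x) (c : E → Bool) {d : E}
    (hd : d ∉ A) (hc : c d = false) :
    fiberSum A w h (Function.update c d true) * fiberSum A w (fun _ => 1) c ≤
      fiberSum A w h c * fiberSum A w (fun _ => 1) (Function.update c d true) := by
  have key := hw.flipDominates (fun e b => if e ∉ A ∧ e ≠ d ∧ b ≠ c e then 0 else 1)
    (fun e b => by split_ifs <;> norm_num) d (fun _ => 1) (IsPF2.const zero_le_one) h h
    fun x y _ _ hxy => hh x y fun e he => hxy.1 e (by rintro rfl; exact hd he)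
  have e1 : ∀ (b : Bool) (x : E → Bool), (if x d = b then
      (w x * ∏ e, if e ∉ A ∧ e ≠ d ∧ x e ≠ c e then (0 : ℝ) else 1) * 1 else 0) =
      if ∀ e, e ∉ A → x e = Function.update c d b e then w x else 0 := by
    intro b x
    by_cases hx : ∀ e, e ∉ A → x e = Function.update c d b e
    · rw [if_pos hx, if_pos (by simpa using hx d hd), Finset.prod_eq_one, mul_one, mul_one]
      intro e _
      refine if_neg ?_
      rintro ⟨h1, h2, h3⟩
      exact h3 (by simpa [h2] using hx e h1)
    · rw [if_neg hx]
      split_ifs with hb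
      · push Not at hx
        obtain ⟨e, he, hne⟩ := hx
        have hed : e ≠ d := by
          rintro rfl
          exact hne (by simpa using hb)
        rw [Finset.prod_eq_zero (Finset.mem_univ e), mul_zero, zero_mul]
        exact if_pos ⟨he, hed, by simpa [hed] using hne⟩
      · rfl
  have e2 : Function.update c d false = c := by rw [← hc, Function.update_eq_self]
  simp only [e1, ite_mul, zero_mul, e2] at key
  simpa only [fiberSum, mul_one] using key

theorem fiberSum_le (hw : IsCovering w) (A : Finset E) {h : (E → Bool) → ℝ}
    (hh : ∀ x y : E → Bool, (∀ e ∈ A, y e ≤ x e) → h y ≤ h x) {c c' : E → Bool}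
    (hcc : ∀ e, e ∉ A → c e ≤ c' e) :
    fiberSum A w h c' * fiberSum A w (fun _ => 1) c ≤
      fiberSum A w h c * fiberSum A w (fun _ => 1) c' := by
  have pos : ∀ c, 0 < fiberSum A w (fun _ => 1) c := fun c =>
    Finset.sum_pos' (fun x _ => by
      split_ifs
      exacts [mul_nonneg (hw.pos x).le zero_le_one, le_rfl])
      ⟨c, Finset.mem_univ _, by
        rw [if_pos fun _ _ => rfl]; exact mul_pos (hw.pos c) one_pos⟩
  have congr : ∀ (g : (E → Bool) → ℝ) {c₁ c₂ : E → Bool}, (∀ e, e ∉ A → c₁ e = c₂ e) →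
      fiberSum A w g c₁ = fiberSum A w g c₂ := fun g c₁ c₂ h12 =>
    Finset.sum_congr rfl fun x _ => if_congr
      (forall_congr' fun e => forall_congr' fun he => by rw [h12 e he]) rfl rfl
  rw [← div_le_div_iff₀ (pos c') (pos c)]
  -- Raise the condition from c to c' on the coordinates of S one at a time; positivity makes every
  -- intermediate quotient meaningful.
  have step : ∀ S : Finset E,
      fiberSum A w h (fun e => if e ∈ S ∧ e ∉ A then c' e else c e) /
        fiberSum A w (fun _ => 1) (fun e => if e ∈ S ∧ e ∉ A then c' e else c e) ≤
      fiberSum A w h c / fiberSum A w (fun _ => 1) c := by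
    intro S
    induction S using Finset.induction_on with
    | empty => simp
    | insert d S hdS ih =>
      refine le_trans ?_ ih
      set c₀ : E → Bool := fun e => if e ∈ S ∧ e ∉ A then c' e else c e
      have hc₀ : c₀ d = c d := if_neg fun h => hdS h.1
      by_cases hd : d ∉ A ∧ c d = false ∧ c' d = true
      · have : (fun e => if e ∈ insert d S ∧ e ∉ A then c' e else c e) =
            Function.update c₀ d true := by
          ext e
          by_cases hed : e = d
          · subst hed
            simp [hd.1, hd.2.2]
          · simp [hed, c₀]
        rw [this, div_le_div_iff₀ (pos _) (pos _)]
        exact hw.fiberSum_update_le A hh c₀ hd.1 (hc₀.trans hd.2.1)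
      · have : (fun e => if e ∈ insert d S ∧ e ∉ A then c' e else c e) = c₀ := by
          ext e
          by_cases hed : e = d
          · subst hed
            rw [hc₀]
            by_cases heA : e ∈ A
            · simp [heA]
            · have := hcc e heA
              simp only [heA, not_false_iff, true_and] at hd
              revert this hd
              cases c e <;> cases c' e <;> simp [heA]
          · simp [hed, c₀]
        rw [this]
  refine le_trans (le_of_eq ?_) (step Finset.univ)
  have : ∀ e, e ∉ A → c' e = if e ∈ Finset.univ ∧ e ∉ A then c' e else c e := fun e he => by
    simp [he]
  rw [congr h this, congr _ this]

end IsCovering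

end Covering

/-! ### Limits of covering weights. -/

section Closure

open Topology

variable {E F : Type u} [Fintype E] [Fintype F] [DecidableEq E] [DecidableEq F]

/-- Smoothing p by a discrete Gaussian keeps total positivity and makes every term positive;
narrowing the Gaussian recovers p. -/
theorem IsPF2.mem_closure_pos {p : ℕ → ℝ} (hp : IsPF2 p) {n : ℕ} (hn : ∀ k, n < k → p k = 0)
    (hp0 : ∃ k, p k ≠ 0) : p ∈ closure {q : ℕ → ℝ | IsPF2 q ∧ ∀ k, 0 < q k} := by
  obtain ⟨k₀, hk₀⟩ := hp0
  have hk₀n : k₀ ≤ n := by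
    by_contra h
    exact hk₀ (hn _ (by omega))
  -- This is the sum of p i * ε ^ ((k - i) ^ 2). Centring at n and reading at n + k brings every i ≤
  -- n into range; at ε = 0 only i = k survives, by 0 ^ 0 = 1.
  set f : ℝ → ℕ → ℝ := fun ε k =>
    IsPF2.conv p (fun m => ε ^ (((m : ℤ) - n).natAbs ^ 2)) (n + k) with hf
  have f0 : f 0 = p := by
    ext k
    simp only [hf, IsPF2.conv]
    rw [Finset.sum_eq_single k]
    · have : ((n + k - k : ℕ) : ℤ) - n = 0 := by omega
      rw [this]
      simp
    · intro i hi hik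
      by_cases hin : n < i
      · rw [hn i hin, zero_mul]
      · have := Finset.mem_range.1 hi
        rw [zero_pow, mul_zero]
        refine pow_ne_zero 2 (Int.natAbs_ne_zero.2 ?_)
        omega
    · intro h
      exact absurd (Finset.mem_range.2 (by omega)) h
  have cont : Continuous f := by
    refine continuous_pi fun k => ?_
    simp only [hf, IsPF2.conv]
    fun_prop
  have lim : Filter.Tendsto f (𝓝[>] 0) (𝓝 p) := by
    have := cont.tendsto 0
    rw [f0] at this
    exact this.mono_left nhdsWithin_le_nhds
  refine mem_closure_of_tendsto lim ?_
  filter_upwards [Ioo_mem_nhdsGT (zero_lt_one (α := ℝ))] with ε hε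
  refine ⟨(hp.isPF2_conv (IsPF2.gaussian hε.1.le hε.2.le n)).shift n, fun k => ?_⟩
  refine Finset.sum_pos' (fun i _ => mul_nonneg (hp.nonneg i) (pow_nonneg hε.1.le _))
    ⟨k₀, Finset.mem_range.2 (by omega), mul_pos ?_ (pow_pos hε.1 _)⟩
  exact lt_of_le_of_ne (hp.nonneg k₀) hk₀.symm

theorem mem_closure_forall_pos {ι : Type*} {g : ι → ℝ} (hg : ∀ i, 0 ≤ g i) :
    g ∈ closure {f : ι → ℝ | ∀ i, 0 < f i} := by
  have cont : Continuous fun (ε : ℝ) (i : ι) => g i + ε := by fun_prop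
  have lim : Filter.Tendsto (fun (ε : ℝ) (i : ι) => g i + ε) (𝓝[>] 0) (𝓝 g) := by
    have := cont.tendsto 0
    simp only [add_zero] at this
    exact this.mono_left nhdsWithin_le_nhds
  refine mem_closure_of_tendsto lim ?_
  filter_upwards [self_mem_nhdsWithin] with ε hε i
  exact add_pos_of_nonneg_of_pos (hg i) hε

/-- A limit of covering weights. -/
def IsCoveringLimit (w : (E → Bool) → ℝ) : Prop := w ∈ closure {v | IsCovering v}

namespace IsCoveringLimit

variable {w : (E → Bool) → ℝ} {v : (F → Bool) → ℝ}

theorem single {w : (PUnit.{u + 1} → Bool) → ℝ} (hw : ∀ x, 0 ≤ w x) : IsCoveringLimit w :=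
  closure_mono (fun _ hf => IsCovering.single hf) (mem_closure_forall_pos hw)

theorem prod (hw : IsCoveringLimit w) (hv : IsCoveringLimit v) :
    IsCoveringLimit (prodWeight w v) :=
  map_mem_closure₂ (f := fun w v => prodWeight w v) (by unfold prodWeight; fun_prop) hw hv
    fun _ h1 _ h2 => h1.prod h2

theorem relabel (hw : IsCoveringLimit w) (e : E ≃ F) :
    IsCoveringLimit fun y : F → Bool => w fun i => y (e i) :=
  map_mem_closure (f := fun (w : (E → Bool) → ℝ) (y : F → Bool) => w fun i => y (e i))
    (by fun_prop) hw fun _ h => h.relabel e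

theorem field (hw : IsCoveringLimit w) {W : E → ℝ} (hW : ∀ e, 0 ≤ W e) :
    IsCoveringLimit fun x => (∏ e, if x e = true then W e else 1) * w x := by
  refine map_mem_closure₂ (f := fun (W : E → ℝ) (w : (E → Bool) → ℝ) (x : E → Bool) =>
    (∏ e, if x e = true then W e else 1) * w x) ?_ (mem_closure_forall_pos hW) hw
    fun _ h1 _ h2 => h2.field h1
  refine continuous_pi fun x => Continuous.mul (continuous_finsetProd _ fun e _ => ?_)
    (by fun_prop)
  split_ifs <;> fun_prop

theorem rescale (hw : IsCoveringLimit w) {p : ℕ → ℝ} (hp : IsPF2 p) {n : ℕ}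
    (hn : ∀ k, n < k → p k = 0) (hp0 : ∃ k, p k ≠ 0) :
    IsCoveringLimit fun x => p (boolRank x) * w x :=
  map_mem_closure₂ (f := fun (p : ℕ → ℝ) (w : (E → Bool) → ℝ) (x : E → Bool) =>
    p (boolRank x) * w x) (by fun_prop) (hp.mem_closure_pos hn hp0) hw
    fun _ h1 _ h2 => h2.rescale h1.1 h1.2

theorem const_mul (hw : IsCoveringLimit w) {c : ℝ} (hc : 0 < c) :
    IsCoveringLimit fun x => c * w x :=
  map_mem_closure (f := fun (w : (E → Bool) → ℝ) x => c * w x) (by fun_prop) hw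
    fun _ h => h.rescale (IsPF2.const hc.le) fun _ => hc

/-- For fixed h, c and c', the inequality is between continuous functions of w, hence defines a
closed set. -/
theorem fiberSum_le (hw : IsCoveringLimit w) (A : Finset E) {h : (E → Bool) → ℝ}
    (hh : ∀ x y : E → Bool, (∀ e ∈ A, y e ≤ x e) → h y ≤ h x) {c c' : E → Bool}
    (hcc : ∀ e, e ∉ A → c e ≤ c' e) :
    fiberSum A w h c' * fiberSum A w (fun _ => 1) c ≤
      fiberSum A w h c * fiberSum A w (fun _ => 1) c' := by
  have cont : ∀ g c, Continuous fun w => fiberSum A w g c := fun g c =>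
    continuous_finsetSum _ fun x _ => by split_ifs <;> fun_prop
  exact closure_minimal (fun v (hv : IsCovering v) => hv.fiberSum_le A hh hcc)
    (isClosed_le ((cont _ _).mul (cont _ _)) ((cont _ _).mul (cont _ _))) hw

end IsCoveringLimit

end Closure

/-! ### The closed class, projections and the theorem. -/

namespace BoolMeasure

variable {E : Type u} [Fintype E]

open Classical in
theorem ClosedClass.isCoveringLimit {μ : BoolMeasure E} (hμ : ClosedClass μ) :
    IsCoveringLimit μ.mass := by
  induction hμ with
  | bernoulli p hp0 hp1 =>
    convert IsCoveringLimit.single (BoolMeasure.bernoulli p hp0 hp1).nonneg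
  | relabel μ e _ ih => exact ih.relabel e
  | prod μ ν _ _ ih1 ih2 =>
    convert ih1.prod ih2
    rfl
  | externalField μ W hW hZ _ ih =>
    convert (ih.field hW).const_mul (inv_pos.2 hZ) using 2 with x
    exact div_eq_inv_mul _ _
  | @rankRescale E _ μ q hq hZ _ ih =>
    -- Approximation by positive sequences needs q not identically zero on 0, …, n, which the
    -- positive normalizing sum guarantees.
    have hq' : ∃ k, (if k ≤ Fintype.card E then q k else 0) ≠ 0 := by
      by_contra! h
      refine hZ.ne' (Finset.sum_eq_zero fun x _ => ?_)
      have := h (boolRank x)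
      rw [if_pos (boolRank_le_card x)] at this
      rw [this, zero_mul]
    convert (ih.rescale (IsPF2.of_isLogConcaveUpTo hq) (n := Fintype.card E)
      (fun k hk => if_neg (by omega)) hq').const_mul (inv_pos.2 hZ) using 2 with x
    rw [if_pos (boolRank_le_card x)]
    exact div_eq_inv_mul _ _

open Classical in
theorem jnrd_of_isCoveringLimit {μ : BoolMeasure E} (hμ : IsCoveringLimit μ.mass) : μ.JNRD := by
  intro A H hH η η' hη h0 h0'
  -- The values of the extension on A do not matter, as fibre sums only see c outside A.
  have ext : ∀ η : (Aᶜ : Set E) → Bool, ∃ c : E → Bool, ∀ e : (Aᶜ : Set E), c e = η e :=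
    fun η => ⟨fun e => if h : e ∈ Aᶜ then η ⟨e, h⟩ else false, fun e => by simp [e.2]⟩
  obtain ⟨c, hc⟩ := ext η
  obtain ⟨c', hc'⟩ := ext η'
  have key := hμ.fiberSum_le A.toFinset
    (h := Set.indicator {x | (fun e : A => x e) ∈ H} fun _ => 1) (c := c) (c' := c') ?_ ?_
  · have e1 : ∀ {η : (Aᶜ : Set E) → Bool} {c : E → Bool}, (∀ e : (Aᶜ : Set E), c e = η e) →
        fiberSum A.toFinset μ.mass (fun _ => 1) c =
          μ.prob {x | (fun e : (Aᶜ : Set E) => x e) = η} := by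
      intro η c hc
      refine Finset.sum_congr rfl fun x _ => ?_
      rw [Set.indicator_apply, mul_one]
      refine if_congr ?_ rfl rfl
      simp only [Set.mem_toFinset, Set.mem_ofPred_eq, funext_iff, ← hc]
      exact ⟨fun h e => h e e.2, fun h e he => h ⟨e, he⟩⟩
    have e2 : ∀ {η : (Aᶜ : Set E) → Bool} {c : E → Bool}, (∀ e : (Aᶜ : Set E), c e = η e) →
        fiberSum A.toFinset μ.mass (Set.indicator {x | (fun e : A => x e) ∈ H} fun _ => 1) c =
          μ.prob ({x | (fun e : A => x e) ∈ H} ∩ {x | (fun e : (Aᶜ : Set E) => x e) = η}) := by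
      intro η c hc
      refine Finset.sum_congr rfl fun x _ => ?_
      have : (∀ e, e ∉ A.toFinset → x e = c e) ↔
          x ∈ {x : E → Bool | (fun e : (Aᶜ : Set E) => x e) = η} := by
        simp only [Set.mem_toFinset, Set.mem_ofPred_eq, funext_iff, ← hc]
        exact ⟨fun h e => h e e.2, fun h e he => h ⟨e, he⟩⟩
      rw [Set.inter_comm, ← Set.indicator_indicator]
      by_cases hx : x ∈ {x : E → Bool | (fun e : (Aᶜ : Set E) => x e) = η}
      · rw [if_pos (this.2 hx), Set.indicator_of_mem hx, Set.indicator_apply,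
          Set.indicator_apply, mul_ite, mul_one, mul_zero]
      · rw [if_neg (this.not.2 hx), Set.indicator_of_notMem hx]
    rw [e1 hc, e1 hc', e2 hc, e2 hc'] at key
    rw [condProb, condProb, div_le_div_iff₀ h0' h0]
    exact key
  · intro x y hxy
    by_cases hy : y ∈ {x : E → Bool | (fun e : A => x e) ∈ H}
    · have hx : x ∈ {x : E → Bool | (fun e : A => x e) ∈ H} :=
        hH (fun e => hxy e (Set.mem_toFinset.2 e.2)) hy
      rw [Set.indicator_of_mem hx, Set.indicator_of_mem hy]
    · rw [Set.indicator_of_notMem hy]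
      exact Set.indicator_nonneg (fun _ _ => zero_le_one) _
  · intro e he
    have he' : e ∈ Aᶜ := fun h => he (Set.mem_toFinset.2 h)
    have := hη ⟨e, he'⟩
    rwa [← hc, ← hc'] at this

open Classical in
theorem prob_proj (μ : BoolMeasure E) (E' : Finset E) (S : Set (E' → Bool)) :
    (μ.proj E').prob S = μ.prob {x | (fun e : E' => x e) ∈ S} := by
  simp only [prob, proj, Set.indicator_apply, Set.mem_ofPred_eq]
  simp_rw [← Finset.sum_filter (p := fun y => y ∈ S)]
  rw [Finset.sum_comm]
  refine Finset.sum_congr rfl fun x _ => ?_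
  rw [Finset.sum_ite_eq]
  simp

theorem JNRD.proj {μ : BoolMeasure E} (hμ : μ.JNRD) (E' : Finset E) : (μ.proj E').JNRD := by
  intro A H hH η η' hη h0 h0'
  -- B is A together with the forgotten coordinates, so conditioning off B in E is conditioning off
  -- A in E', and events in the A-coordinates stay increasing events on B.
  set B : Set E := {e | ∀ h : e ∈ E', (⟨e, h⟩ : E') ∈ A} with hB
  have memB : ∀ a : A, (a : E').1 ∈ B := fun a _ => a.2
  have memBc : ∀ e : (Bᶜ : Set E), ∃ h : e.1 ∈ E', (⟨e.1, h⟩ : E') ∈ Aᶜ := fun e => by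
    have := e.2
    simp only [hB, Set.mem_compl_iff, Set.mem_ofPred_eq, not_forall] at this
    exact this
  have e1 : ∀ η : (Aᶜ : Set E') → Bool,
      {x : E → Bool | (fun e : E' => x e) ∈ {x : E' → Bool | (fun e : (Aᶜ : Set E') => x e) = η}} =
      {x | (fun e : (Bᶜ : Set E) => x e) = fun e => η ⟨⟨e.1, (memBc e).1⟩, (memBc e).2⟩} := by
    intro η
    ext x
    simp only [Set.mem_ofPred_eq, funext_iff]
    refine ⟨fun h e => h ⟨⟨e.1, (memBc e).1⟩, (memBc e).2⟩, fun h e => ?_⟩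
    exact h ⟨e.1.1, fun h => e.2 (h e.1.2)⟩
  rw [prob_proj, e1] at h0 h0'
  have key := hμ B {y | (fun a : A => y ⟨a.1.1, memB a⟩) ∈ H}
    (fun y y' hy hyH => hH (fun a => hy _) hyH) _ _ (fun e => hη _) h0 h0'
  simp only [condProb] at key ⊢
  rw [prob_proj, prob_proj, prob_proj, prob_proj, e1, e1]
  have e2 : ∀ S T : Set (E' → Bool), {x : E → Bool | (fun e : E' => x e) ∈ S ∩ T} =
    {x | (fun e : E' => x e) ∈ S} ∩ {x | (fun e : E' => x e) ∈ T} := fun _ _ => rfl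
  rw [e2, e2, e1, e1]
  exact key

end BoolMeasure

theorem mainTheorem1 {E : Type u} [Fintype E] (μ : BoolMeasure E)
    (hμ : BoolMeasure.ClosedClass μ) : μ.JNRDPlus :=
  ⟨BoolMeasure.jnrd_of_isCoveringLimit hμ.isCoveringLimit, fun W hW hZ E' =>
    (BoolMeasure.jnrd_of_isCoveringLimit
      (hμ.externalField μ W hW hZ).isCoveringLimit).proj E'⟩
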